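/- Let $\mathcal H$ be a finite-dimensional real Hilbert space and let $f,g\colon\mathcal H\to\left]-\infty,+\infty\right]$ be proper lower semicontinuous convex functions. For such a function $h$ write $\operatorname{dom} h=\{x\in\mathcal H : h(x)<+\infty\}$, $h^*(u)=\sup_{x\in\mathcal H}\bigl(\langle x,u\rangle-h(x)\bigr)$ for its Fenchel conjugate, and $\operatorname{prox}_h(x)=\operatorname{argmin}_{y\in\mathcal H}\bigl(h(y)+\tfrac12\|y-x\|^2\bigr)$ for its proximity operator. Let $v_p$ be the projection of $0$ onto $\overline{\operatorname{dom} f-\operatorname{dom} g}$ and $v_d$ the projection of $0$ onto $\overline{\operatorname{dom} f^*+\operatorname{dom} g^*}$. Given $s_0\in\mathcal H$, let the Douglas–Rachford iterates be defined, for $n=0,1,2,\dots$, by $$x_n=\operatorname{prox}_f(s_n),\qquad \nu_n=s_n-x_n,\qquad \tilde x_n=\operatorname{prox}_g(2x_n-s_n),\qquad s_{n+1}=s_n+\tilde x_n-x_n .$$ Then, for every $s_0\in\mathcal H$, as $n\to\infty$, $$-\tfrac1n\,(x_n,\tilde x_n,\nu_n)\;\longrightarrow\;(v_d,v_d,v_p).$$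 -/

import Mathlib

open Filter Topology
open scoped Pointwise

noncomputable section

namespace DouglasRachford

variable {H : Type*} [NormedAddCommGroup H] [InnerProductSpace ℝ H]

/-- `f` is a proper lower semicontinuous convex function `H → ]-∞, +∞]`. Convexity is convexity of
the epigraph, a subset of `H × ℝ`. -/
structure IsProperLscConvex (f : H → EReal) : Prop where
  ne_bot : ∀ x, f x ≠ ⊥
  exists_ne_top : ∃ x, f x ≠ ⊤
  lsc : LowerSemicontinuous f
  convex_epigraph : Convex ℝ {p : H × ℝ | f p.1 ≤ (p.2 : EReal)}

/-- The domain `dom f = {x | f x < +∞}`. -/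
def dom (f : H → EReal) : Set H := {x | f x < ⊤}

/-- The Fenchel conjugate `f* u = sup_x (⟪x, u⟫ - f x)`. -/
def conj (f : H → EReal) (u : H) : EReal := ⨆ x : H, ((inner ℝ x u : ℝ) : EReal) - f x

/-- The proximity operator: `prox f x` is a minimizer of `y ↦ f y + ½ ‖y - x‖²` over `H`
(it exists and is unique when `f` is proper lower semicontinuous convex). -/
def prox (f : H → EReal) (x : H) : H :=
  Classical.epsilon fun p =>
    IsMinOn (fun y => f y + ((1 / 2 * ‖y - x‖ ^ 2 : ℝ) : EReal)) Set.univ p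

/-- The projection operator: `proj C x` is a point of `C` nearest to `x`
(it exists and is unique when `C` is nonempty, closed and convex in a complete space). -/
def proj (C : Set H) (x : H) : H :=
  Classical.epsilon fun p => p ∈ C ∧ IsMinOn (fun y => ‖y - x‖) C p

/-- The vector `v_p`, the projection of `0` onto the closure of `dom f - dom g`. -/
def vp (f g : H → EReal) : H := proj (closure (dom f - dom g)) 0

/-- The vector `v_d`, the projection of `0` onto the closure of `dom f* + dom g*`. -/
def vd (f g : H → EReal) : H := proj (closure (dom (conj f) + dom (conj g))) 0

/-- The governing sequence `s_{n+1} = s_n + x̃_n - x_n`, with `x_n = prox_f s_n` and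
`x̃_n = prox_g (2 x_n - s_n)`. -/
def sSeq (f g : H → EReal) (s₀ : H) : ℕ → H
  | 0 => s₀
  | n + 1 =>
    sSeq f g s₀ n + prox g ((2 : ℝ) • prox f (sSeq f g s₀ n) - sSeq f g s₀ n)
      - prox f (sSeq f g s₀ n)

/-- `x_n = prox_f s_n`. -/
def xSeq (f g : H → EReal) (s₀ : H) (n : ℕ) : H := prox f (sSeq f g s₀ n)

/-- `ν_n = s_n - x_n`. -/
def nuSeq (f g : H → EReal) (s₀ : H) (n : ℕ) : H := sSeq f g s₀ n - xSeq f g s₀ n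

/-- `x̃_n = prox_g (2 x_n - s_n)`. -/
def xtSeq (f g : H → EReal) (s₀ : H) (n : ℕ) : H :=
  prox g ((2 : ℝ) • xSeq f g s₀ n - sSeq f g s₀ n)

end DouglasRachford

end

/-!
Write `ν = s - x`, `w = x - x̃` and `μ = w - ν` for a step of the iteration from `s`, so that `ν` is
a subgradient of `f` at `x`, `μ` is a subgradient of `g` at `x̃`, and `s` moves to `s - w`. The
displacement `w = x - x̃ = ν + μ` lies in `dom f - dom g` and in `dom f* + dom g*`. The functions
enter the estimates only through the inequality

  `⟪ν, a⟫ + ⟪x, c⟫ - ⟪x, ν⟫ ≤ f a + f* c`   for all `a ∈ dom f` and `c ∈ dom f*`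

(`IsSubgradient.inner_le`) and its analogue for `g`, together with the following facts on `v_p` and
`v_d`. By the variational inequality of the projection, `⟪·, v_p⟫` is bounded below on `dom f` and
above on `dom g`, so `f*` and `g*` grow at most linearly along `-v_p` and `v_p` respectively;
dually, by the Fenchel–Moreau theorem, `f` and `g` both grow at most linearly along `-v_d`.
Consequently `v_p ⟂ v_d` (`inner_vp_vd`), and `v = v_p + v_d` lies in the closures of both
`dom f - dom g` and `dom f* + dom g*`.

* `s_n = -n v + o(n)` (`isLittleO_sSeq_add`). Adding the two inequalities with `a - b` and `c + d`
  both close to `v` gives `⟪s, v - w⟫ ≤ O(1 + ‖w‖) - ‖w‖² + ε O(‖s‖ + 1)`, while `⟪v, v - w⟫ ≤ 0`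
  because `w` lies in both sets. Hence `u_n = s_n + n v` satisfies
  `‖u_{n+1}‖² ≤ ‖u_n‖² + C_δ + δ (‖u_n‖ + n)` for every `δ > 0`, which forces `‖u_n‖ = o(n)`.
* `x_n = -n v_d + o(n)` (`isLittleO_xSeq_add`). Take the base points `a - n v_d` and `c - n v_p`,
  which cost only `O(n)` in `f` and `f*`. The inequality becomes
  `⟪x_n + n v_d, ν_n + n v_p⟫ ≥ -o(n²)`. The sum of these two vectors is `u_n = o(n)`, so each of
  them is `o(n)`.

The limit for `ν_n = s_n - x_n` follows, and that for `x̃_n` because `x̃_n - x_n = s_{n+1} - s_n`.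
-/

namespace DouglasRachford

open scoped InnerProductSpace

/-! ### Subgradients and conjugates -/

lemma mem_dom_of_le {H : Type*} {f : H → EReal} {x : H} {r : ℝ} (h : f x ≤ r) : x ∈ dom f :=
  lt_of_le_of_lt h (EReal.coe_lt_top r)

section Convex

variable {H : Type*} [NormedAddCommGroup H] [InnerProductSpace ℝ H]

/-- `u` is a subgradient of `f` at `x`. The value `f x` is required to be finite, and the
subgradient inequality is tested against real upper bounds `r` of `f y`, which avoids arithmetic
in `EReal`. -/
def IsSubgradient (f : H → EReal) (x u : H) : Prop :=
  ∃ φ : ℝ, f x = φ ∧ ∀ (y : H) (r : ℝ), f y ≤ r → φ + ⟪u, y - x⟫_ℝ ≤ r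

lemma exists_coe_eq {f : H → EReal} (hf : IsProperLscConvex f) {x : H} (hx : x ∈ dom f) :
    ∃ φ : ℝ, f x = φ :=
  ⟨(f x).toReal, (EReal.coe_toReal (ne_of_lt hx) (hf.ne_bot x)).symm⟩

lemma IsProperLscConvex.dom_nonempty {f : H → EReal} (hf : IsProperLscConvex f) :
    (dom f).Nonempty :=
  hf.exists_ne_top.imp fun _ hx => lt_top_iff_ne_top.2 hx

lemma conj_le_coe_iff {f : H → EReal} {u : H} {γ : ℝ} :
    conj f u ≤ γ ↔ ∀ (x : H) (r : ℝ), f x ≤ r → ⟪x, u⟫_ℝ - γ ≤ r := by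
  unfold conj
  rw [iSup_le_iff]
  refine forall_congr' fun x => ?_
  induction hfx : f x with
  | bot =>
    simp only [EReal.coe_sub_bot, top_le_iff, EReal.coe_ne_top, bot_le, forall_const, false_iff,
      not_forall, not_le]
    exact ⟨⟪x, u⟫_ℝ - γ - 1, by linarith⟩
  | top => simp
  | coe φ =>
    rw [← EReal.coe_sub, EReal.coe_le_coe_iff]
    constructor
    · intro h r hr
      have := EReal.coe_le_coe_iff.1 hr
      linarith
    · intro h
      have := h φ le_rfl
      linarith

lemma conj_ne_bot {f : H → EReal} (hf : IsProperLscConvex f) (u : H) : conj f u ≠ ⊥ := by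
  obtain ⟨x, hx⟩ := hf.dom_nonempty
  obtain ⟨φ, hφ⟩ := exists_coe_eq hf hx
  intro h
  have h1 : conj f u ≤ ((⟪x, u⟫_ℝ - φ - 1 : ℝ) : EReal) := by rw [h]; exact bot_le
  have := conj_le_coe_iff.1 h1 x φ hφ.le
  linarith

lemma exists_conj_le {f : H → EReal} (hf : IsProperLscConvex f) {u : H} (hu : u ∈ dom (conj f)) :
    ∃ γ : ℝ, conj f u ≤ γ :=
  ⟨(conj f u).toReal, (EReal.coe_toReal (ne_of_lt hu) (conj_ne_bot hf u)).symm.le⟩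

lemma IsSubgradient.mem_dom {f : H → EReal} {x u : H} (h : IsSubgradient f x u) : x ∈ dom f := by
  obtain ⟨φ, hφ, -⟩ := h
  exact mem_dom_of_le hφ.le

lemma IsSubgradient.mem_dom_conj {f : H → EReal} {x u : H} (h : IsSubgradient f x u) :
    u ∈ dom (conj f) := by
  obtain ⟨φ, -, h⟩ := h
  refine mem_dom_of_le (r := ⟪x, u⟫_ℝ - φ) (conj_le_coe_iff.2 fun y r hr => ?_)
  have := h y r hr
  rw [inner_sub_right, real_inner_comm, real_inner_comm x] at this
  linarith

/-- The one inequality through which `f` enters the estimates on the iterates. It compares a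
point `(x, ν)` of the graph of the subdifferential with an arbitrary pair `(a, c)` in
`dom f × dom f*`, whose members are unrelated to each other. -/
lemma IsSubgradient.inner_le {f : H → EReal} {x ν : H} (h : IsSubgradient f x ν) {a c : H}
    {α γ : ℝ} (ha : f a ≤ α) (hc : conj f c ≤ γ) :
    ⟪ν, a⟫_ℝ + ⟪x, c⟫_ℝ - ⟪x, ν⟫_ℝ ≤ α + γ := by
  obtain ⟨φ, hφ, h⟩ := h
  have h1 := h a α ha
  have h2 := conj_le_coe_iff.1 hc x φ hφ.le
  rw [inner_sub_right, real_inner_comm x ν] at h1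
  linarith

lemma IsSubgradient.monotone {f : H → EReal} {x ν y μ : H} (h : IsSubgradient f x ν)
    (h' : IsSubgradient f y μ) : 0 ≤ ⟪x - y, ν - μ⟫_ℝ := by
  obtain ⟨φ, hφ, h⟩ := h
  obtain ⟨ψ, hψ, h'⟩ := h'
  have h1 := h y ψ hψ.le
  have h2 := h' x φ hφ.le
  have : ⟪x - y, ν - μ⟫_ℝ = -⟪ν, y - x⟫_ℝ - ⟪μ, x - y⟫_ℝ := by
    rw [real_inner_comm, inner_sub_left, ← neg_sub y x, inner_neg_right, inner_neg_right]
  linarith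

lemma convex_comb_le {f : H → EReal} (hf : IsProperLscConvex f) {x y : H} {r r' : ℝ}
    (hx : f x ≤ r) (hy : f y ≤ r') {a b : ℝ} (ha : 0 ≤ a) (hb : 0 ≤ b) (hab : a + b = 1) :
    f (a • x + b • y) ≤ ((a * r + b * r' : ℝ) : EReal) := by
  have := hf.convex_epigraph (x := (x, r)) (y := (y, r')) hx hy ha hb hab
  simpa using this

lemma convex_dom {f : H → EReal} (hf : IsProperLscConvex f) : Convex ℝ (dom f) := by
  intro x hx y hy a b ha hb hab
  obtain ⟨r, hr⟩ := exists_coe_eq hf hx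
  obtain ⟨r', hr'⟩ := exists_coe_eq hf hy
  exact mem_dom_of_le (convex_comb_le hf hr.le hr'.le ha hb hab)

lemma convex_dom_conj {f : H → EReal} (hf : IsProperLscConvex f) : Convex ℝ (dom (conj f)) := by
  intro x hx y hy a b ha hb hab
  obtain ⟨γ, hγ⟩ := exists_conj_le hf hx
  obtain ⟨γ', hγ'⟩ := exists_conj_le hf hy
  refine mem_dom_of_le (r := a * γ + b * γ') (conj_le_coe_iff.2 fun z r hr => ?_)
  have h1 := mul_le_mul_of_nonneg_left (conj_le_coe_iff.1 hγ z r hr) ha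
  have h2 := mul_le_mul_of_nonneg_left (conj_le_coe_iff.1 hγ' z r hr) hb
  have h3 : a * r + b * r = r := by rw [← add_mul, hab, one_mul]
  rw [inner_add_right, inner_smul_right, inner_smul_right]
  linarith

/-- If `⟪·, d⟫` is bounded above by `m` on `dom f`, then `f*` has slope at most `m` in the
direction `d`. -/
lemma conj_add_smul_le {f : H → EReal} {d c : H} {m γ t : ℝ} (hd : ∀ x ∈ dom f, ⟪x, d⟫_ℝ ≤ m)
    (ht : 0 ≤ t) (hc : conj f c ≤ γ) : conj f (c + t • d) ≤ ((γ + t * m : ℝ) : EReal) := by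
  refine conj_le_coe_iff.2 fun x r hr => ?_
  have h1 := conj_le_coe_iff.1 hc x r hr
  have h2 := mul_le_mul_of_nonneg_left (hd x (mem_dom_of_le hr)) ht
  rw [inner_add_right, inner_smul_right]
  linarith

/-! ### Affine minorants and biconjugation -/

/-- A non-vertical separating hyperplane is the graph of an affine minorant. -/
lemma exists_conj_le_of_separation {f : H → EReal} {y u : H} {r β κ : ℝ} (hβ : 0 < β)
    (h : ∀ (x : H) (t : ℝ), f x ≤ t → ⟪x, u⟫_ℝ - β * t < κ) (hy : κ < ⟪y, u⟫_ℝ - β * r) :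
    ∃ (w : H) (γ : ℝ), conj f w ≤ γ ∧ r < ⟪y, w⟫_ℝ - γ := by
  refine ⟨β⁻¹ • u, β⁻¹ * κ, conj_le_coe_iff.2 fun x t ht => ?_, ?_⟩
  · have := mul_le_mul_of_nonneg_left (h x t ht).le (inv_nonneg.2 hβ.le)
    rw [mul_sub, inv_mul_cancel_left₀ hβ.ne'] at this
    rw [inner_smul_right]; linarith
  · have := mul_lt_mul_of_pos_left hy (inv_pos.2 hβ)
    rw [mul_sub, inv_mul_cancel_left₀ hβ.ne'] at this
    rw [inner_smul_right]; linarith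

variable [CompleteSpace H]

lemma exists_separation {f : H → EReal} (hf : IsProperLscConvex f) {y : H} {r : ℝ}
    (hr : ¬ f y ≤ r) :
    ∃ (u : H) (β κ : ℝ), 0 ≤ β ∧ (∀ (x : H) (t : ℝ), f x ≤ t → ⟪x, u⟫_ℝ - β * t < κ) ∧
      κ < ⟪y, u⟫_ℝ - β * r := by
  have hcl : IsClosed {p : H × ℝ | f p.1 ≤ (p.2 : EReal)} := by
    have := hf.lsc.isClosed_epigraph
    exact this.preimage
      (f := fun p : H × ℝ => (p.1, (p.2 : EReal)))
      (continuous_fst.prodMk (continuous_coe_real_ereal.comp continuous_snd))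
  obtain ⟨φ, κ, h1, h2⟩ := geometric_hahn_banach_closed_point hf.convex_epigraph hcl
    (x := (y, r)) hr
  set u : H := (InnerProductSpace.toDual ℝ H).symm (φ.comp (ContinuousLinearMap.inl ℝ H ℝ))
  have hφ : ∀ (x : H) (t : ℝ), φ (x, t) = ⟪x, u⟫_ℝ - -φ (0, 1) * t := by
    intro x t
    have e1 : ⟪x, u⟫_ℝ = φ (x, 0) := by
      rw [real_inner_comm, InnerProductSpace.toDual_symm_apply]; simp
    have e2 : (x, t) = (x, (0 : ℝ)) + t • ((0 : H), (1 : ℝ)) := by simp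
    rw [e1, e2, map_add, map_smul, smul_eq_mul]; ring
  have h1' : ∀ (x : H) (t : ℝ), f x ≤ t → ⟪x, u⟫_ℝ - -φ (0, 1) * t < κ := fun x t ht => by
    rw [← hφ]; exact h1 (x, t) ht
  refine ⟨u, -φ (0, 1), κ, ?_, h1', by rw [← hφ]; exact h2⟩
  -- The epigraph contains a vertical upward ray, on which the functional is bounded above.
  by_contra! hneg
  obtain ⟨x, hx⟩ := hf.dom_nonempty
  obtain ⟨t, ht⟩ := exists_coe_eq hf hx
  have hb : 0 < φ (0, 1) := by linarith
  set M := max t ((κ - ⟪x, u⟫_ℝ) / φ (0, 1))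
  have h3 := h1' x M (by rw [ht]; exact EReal.coe_le_coe_iff.2 (le_max_left _ _))
  have h4 : (κ - ⟪x, u⟫_ℝ) / φ (0, 1) ≤ M := le_max_right _ _
  rw [div_le_iff₀ hb] at h4
  linarith

lemma dom_conj_nonempty {f : H → EReal} (hf : IsProperLscConvex f) : (dom (conj f)).Nonempty := by
  obtain ⟨x, hx⟩ := hf.dom_nonempty
  obtain ⟨φ, hφ⟩ := exists_coe_eq hf hx
  have hr : ¬ f x ≤ ((φ - 1 : ℝ) : EReal) := by
    rw [hφ, EReal.coe_le_coe_iff]; linarith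
  obtain ⟨u, β, κ, hβ, h1, h2⟩ := exists_separation hf hr
  have h3 := h1 x φ hφ.le
  obtain ⟨w, γ, hw, -⟩ := exists_conj_le_of_separation (by linarith) h1 h2
  exact ⟨w, mem_dom_of_le hw⟩

/-- The Fenchel–Moreau theorem `f = f**`, in the form used here: every real `r < f y` is exceeded
at `y` by an affine minorant of `f`. -/
lemma exists_conj_le_lt {f : H → EReal} (hf : IsProperLscConvex f) {y : H} {r : ℝ}
    (hr : ¬ f y ≤ r) : ∃ (u : H) (γ : ℝ), conj f u ≤ γ ∧ r < ⟪y, u⟫_ℝ - γ := by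
  obtain ⟨u, β, κ, hβ, h1, h2⟩ := exists_separation hf hr
  rcases hβ.lt_or_eq with hβ | rfl
  · exact exists_conj_le_of_separation hβ h1 h2
  -- A vertical hyperplane is tilted by adding a large multiple of it to some affine minorant.
  obtain ⟨w, hw⟩ := dom_conj_nonempty hf
  obtain ⟨γ, hγ⟩ := exists_conj_le hf hw
  simp only [zero_mul, sub_zero] at h1 h2
  have hpos : 0 < ⟪y, u⟫_ℝ - κ := by linarith
  set N := (|r - (⟪y, w⟫_ℝ - γ)| + 1) / (⟪y, u⟫_ℝ - κ)
  have hN : 0 ≤ N := by positivity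
  have hN' : N * (⟪y, u⟫_ℝ - κ) = |r - (⟪y, w⟫_ℝ - γ)| + 1 := div_mul_cancel₀ _ hpos.ne'
  refine ⟨w + N • u, γ + N * κ, conj_le_coe_iff.2 fun x t ht => ?_, ?_⟩
  · have e1 := conj_le_coe_iff.1 hγ x t ht
    have e2 := mul_le_mul_of_nonneg_left (h1 x t ht).le hN
    rw [inner_add_right, inner_smul_right]
    linarith
  · have := le_abs_self (r - (⟪y, w⟫_ℝ - γ))
    rw [inner_add_right, inner_smul_right]
    linarith

/-- If `⟪·, d⟫` is bounded above by `m` on `dom f*`, then `f` has slope at most `m` in the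
direction `d`. -/
lemma add_smul_le {f : H → EReal} (hf : IsProperLscConvex f) {d a : H} {m α t : ℝ}
    (hd : ∀ u ∈ dom (conj f), ⟪u, d⟫_ℝ ≤ m) (ht : 0 ≤ t) (ha : f a ≤ α) :
    f (a + t • d) ≤ ((α + t * m : ℝ) : EReal) := by
  by_contra hr
  obtain ⟨u, γ, hu, hlt⟩ := exists_conj_le_lt hf hr
  have h1 := conj_le_coe_iff.1 hu a α ha
  have h2 := mul_le_mul_of_nonneg_left (hd u (mem_dom_of_le hu)) ht
  rw [inner_add_left, inner_smul_left, real_inner_comm u d] at hlt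
  simp only [conj_trivial] at hlt
  linarith

end Convex

/-! ### Projections and proximity operators -/

section Prox

variable {H : Type*} [NormedAddCommGroup H] [InnerProductSpace ℝ H]

lemma proj_zero_spec [CompleteSpace H] {C : Set H} (hne : C.Nonempty) (hcl : IsClosed C)
    (hcv : Convex ℝ C) : proj C 0 ∈ C ∧ ∀ y ∈ C, ‖proj C 0‖ ^ 2 ≤ ⟪proj C 0, y⟫_ℝ := by
  have hex : ∃ p, p ∈ C ∧ IsMinOn (fun y => ‖y - (0 : H)‖) C p := by
    obtain ⟨p, hp, hmin⟩ := exists_norm_eq_iInf_of_complete_convex hne hcl.isComplete hcv 0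
    refine ⟨p, hp, fun y hy => ?_⟩
    have hbdd : BddBelow (Set.range fun w : C => ‖(0 : H) - w‖) :=
      ⟨0, by rintro _ ⟨w, rfl⟩; exact norm_nonneg _⟩
    have := ciInf_le hbdd ⟨y, hy⟩
    rw [← hmin] at this
    simpa using this
  obtain ⟨hp, hmin⟩ := Classical.epsilon_spec hex
  change proj C 0 ∈ C at hp
  change IsMinOn _ C (proj C 0) at hmin
  refine ⟨hp, fun y hy => ?_⟩
  have heq : ‖(0 : H) - proj C 0‖ = ⨅ w : C, ‖(0 : H) - w‖ := by
    have : Nonempty C := ⟨⟨_, hp⟩⟩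
    refine le_antisymm (le_ciInf fun w => ?_) (ciInf_le ⟨0, ?_⟩ (⟨_, hp⟩ : C))
    · simpa using hmin w.2
    · rintro _ ⟨w, rfl⟩; exact norm_nonneg _
  have := (norm_eq_iInf_iff_real_inner_le_zero hcv hp).1 heq y hy
  rw [zero_sub, inner_neg_left, inner_sub_right, real_inner_self_eq_norm_sq] at this
  linarith

variable [FiniteDimensional ℝ H]

/-- The proximal objective has a minimizer: an affine minorant of `f` makes it coercive. -/
lemma exists_isMinOn_prox {f : H → EReal} (hf : IsProperLscConvex f) (x : H) :
    ∃ p, IsMinOn (fun y => f y + ((1 / 2 * ‖y - x‖ ^ 2 : ℝ) : EReal)) Set.univ p := by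
  have : CompleteSpace H := FiniteDimensional.complete ℝ H
  have : ProperSpace H := FiniteDimensional.proper ℝ H
  set F : H → EReal := fun y => f y + ((1 / 2 * ‖y - x‖ ^ 2 : ℝ) : EReal)
  have hF : LowerSemicontinuous F := by
    refine hf.lsc.add' ?_ fun y => ?_
    · exact (continuous_coe_real_ereal.comp (by fun_prop)).lowerSemicontinuous
    · exact EReal.continuousAt_add (Or.inr (EReal.coe_ne_bot _)) (Or.inr (EReal.coe_ne_top _))
  obtain ⟨u, hu⟩ := dom_conj_nonempty hf
  obtain ⟨γ, hγ⟩ := exists_conj_le hf hu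
  obtain ⟨x₀, hx₀⟩ := hf.dom_nonempty
  obtain ⟨φ, hφ⟩ := exists_coe_eq hf hx₀
  set M : ℝ := φ + 1 / 2 * ‖x₀ - x‖ ^ 2
  have hM : F x₀ = (M : EReal) := by
    simp only [F, M, hφ, EReal.coe_add]
  set M' : ℝ := M + γ - ⟪x, u⟫_ℝ
  set R : ℝ := |4 * M' + 4 * ‖u‖ ^ 2| + 1
  have hball : ∀ y, F y ≤ (M : EReal) → y ∈ Metric.closedBall x R := by
    intro y hy
    rw [mem_closedBall_iff_norm]
    have h1 : f y ≤ ((M - 1 / 2 * ‖y - x‖ ^ 2 : ℝ) : EReal) := by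
      rw [EReal.coe_sub]
      exact EReal.le_sub_iff_add_le (Or.inl (EReal.coe_ne_bot _)) (Or.inl (EReal.coe_ne_top _))
        |>.2 hy
    have h2 := conj_le_coe_iff.1 hγ y _ h1
    have h3 : ⟪y, u⟫_ℝ = ⟪x, u⟫_ℝ + ⟪y - x, u⟫_ℝ := by rw [inner_sub_left]; ring
    have h4 := neg_le_of_abs_le (abs_real_inner_le_norm (y - x) u)
    have h5 := le_abs_self (4 * M' + 4 * ‖u‖ ^ 2)
    have h6 : ‖y - x‖ ^ 2 ≤ 4 * M' + 4 * ‖u‖ ^ 2 := by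
      nlinarith [sq_nonneg (‖y - x‖ - 2 * ‖u‖)]
    by_contra! hlt
    have : 1 ≤ R := by simp [R]
    nlinarith
  obtain ⟨p, -, hp⟩ := LowerSemicontinuousOn.exists_isMinOn ⟨x₀, hball x₀ hM.le⟩
    (isCompact_closedBall x R) (hF.lowerSemicontinuousOn _)
  refine ⟨p, fun y _ => ?_⟩
  change F p ≤ F y
  by_cases hy : F y ≤ M
  · exact hp (hball y hy)
  · exact (hp (hball x₀ hM.le)).trans (hM.le.trans (not_le.1 hy).le)

lemma isSubgradient_prox {f : H → EReal} (hf : IsProperLscConvex f) (x : H) :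
    IsSubgradient f (prox f x) (x - prox f x) := by
  have hmin : IsMinOn (fun y => f y + ((1 / 2 * ‖y - x‖ ^ 2 : ℝ) : EReal)) Set.univ (prox f x) :=
    Classical.epsilon_spec (exists_isMinOn_prox hf x)
  set p := prox f x
  have hle : ∀ (y : H) (r : ℝ), f y ≤ r →
      f p ≤ ((r + 1 / 2 * ‖y - x‖ ^ 2 - 1 / 2 * ‖p - x‖ ^ 2 : ℝ) : EReal) := by
    intro y r hr
    rw [EReal.coe_sub]
    refine EReal.le_sub_iff_add_le (Or.inl (EReal.coe_ne_bot _)) (Or.inl (EReal.coe_ne_top _))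
        |>.2 ((hmin (Set.mem_univ y)).trans ?_)
    rw [EReal.coe_add]
    exact add_le_add_left hr _
  obtain ⟨x₀, hx₀⟩ := hf.dom_nonempty
  obtain ⟨φ₀, hφ₀⟩ := exists_coe_eq hf hx₀
  obtain ⟨φ, hφ⟩ := exists_coe_eq hf (mem_dom_of_le (hle x₀ φ₀ hφ₀.le))
  refine ⟨φ, hφ, fun y r hr => ?_⟩
  -- Minimality along the segment from `p` to `y`, divided by `t` and taken to the limit `t → 0`.
  have key : ∀ t : ℝ, 0 < t → t ≤ 1 → φ + ⟪x - p, y - p⟫_ℝ ≤ r + t * (1 / 2 * ‖y - p‖ ^ 2) := by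
    intro t ht ht1
    have h1 := hle _ _ (convex_comb_le hf hφ.le hr (a := 1 - t) (b := t) (by linarith) ht.le
      (by ring))
    rw [hφ, EReal.coe_le_coe_iff] at h1
    have e : (1 - t) • p + t • y - x = (p - x) + t • (y - p) := by module
    rw [e, norm_add_sq_real, inner_smul_right, norm_smul, mul_pow, Real.norm_eq_abs, sq_abs] at h1
    have e2 : ⟪p - x, y - p⟫_ℝ = -⟪x - p, y - p⟫_ℝ := by rw [← inner_neg_left, neg_sub]
    rw [e2] at h1
    have : t * (φ + ⟪x - p, y - p⟫_ℝ) ≤ t * (r + t * (1 / 2 * ‖y - p‖ ^ 2)) := by linarith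
    exact le_of_mul_le_mul_left this ht
  have hlim : Tendsto (fun t : ℝ => r + t * (1 / 2 * ‖y - p‖ ^ 2)) (𝓝[>] 0) (𝓝 r) := by
    have : Tendsto (fun t : ℝ => r + t * (1 / 2 * ‖y - p‖ ^ 2)) (𝓝 0)
        (𝓝 (r + 0 * (1 / 2 * ‖y - p‖ ^ 2))) := by
      exact Continuous.tendsto (by fun_prop) 0
    rw [zero_mul, add_zero] at this
    exact this.mono_left nhdsWithin_le_nhds
  refine ge_of_tendsto hlim ?_
  filter_upwards [Ioc_mem_nhdsGT (zero_lt_one' ℝ)] with t ht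
  exact key t ht.1 ht.2

/-- Both `prox f s` and `s - prox f s` grow at most linearly in `s`. -/
lemma exists_norm_prox_le {f : H → EReal} (hf : IsProperLscConvex f) :
    ∃ K : ℝ, 0 ≤ K ∧ ∀ s, ‖prox f s‖ ≤ ‖s‖ + K ∧ ‖s - prox f s‖ ≤ ‖s‖ + K := by
  refine ⟨‖prox f 0‖, norm_nonneg _, fun s => ?_⟩
  have h := (isSubgradient_prox hf s).monotone (isSubgradient_prox hf 0)
  set p := prox f s
  set q := prox f 0
  have e : ‖s‖ ^ 2 = ‖p - q‖ ^ 2 + 2 * ⟪p - q, s - p - (0 - q)⟫_ℝ + ‖s - p - (0 - q)‖ ^ 2 := by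
    rw [← norm_add_sq_real]; congr 2; abel
  have h1 : ‖p - q‖ ≤ ‖s‖ := abs_le_of_sq_le_sq' (by nlinarith [sq_nonneg ‖s - p - (0 - q)‖])
    (norm_nonneg _) |>.2
  have h2 : ‖s - p - (0 - q)‖ ≤ ‖s‖ :=
    abs_le_of_sq_le_sq' (by nlinarith [sq_nonneg ‖p - q‖]) (norm_nonneg _) |>.2
  constructor
  · calc ‖p‖ = ‖(p - q) + q‖ := by rw [sub_add_cancel]
      _ ≤ ‖s‖ + ‖q‖ := (norm_add_le _ _).trans (by gcongr)
  · calc ‖s - p‖ = ‖(s - p - (0 - q)) + -q‖ := by congr 1; abel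
      _ ≤ ‖s‖ + ‖q‖ := (norm_add_le _ _).trans (by rw [norm_neg]; gcongr)

end Prox

/-! ### The vectors `v_p` and `v_d` -/

section Displacement

variable {H : Type*} [NormedAddCommGroup H] [InnerProductSpace ℝ H] {f g : H → EReal}

lemma vd_comm : vd g f = vd f g := by
  unfold vd
  rw [add_comm]

variable [CompleteSpace H]

lemma vp_spec (hf : IsProperLscConvex f) (hg : IsProperLscConvex g) :
    vp f g ∈ closure (dom f - dom g) ∧
      ∀ a ∈ dom f, ∀ b ∈ dom g, ‖vp f g‖ ^ 2 ≤ ⟪vp f g, a - b⟫_ℝ := by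
  obtain ⟨h1, h2⟩ := proj_zero_spec (hf.dom_nonempty.sub hg.dom_nonempty).closure
    isClosed_closure ((convex_dom hf).sub (convex_dom hg)).closure
  exact ⟨h1, fun a ha b hb => h2 _ (subset_closure (Set.sub_mem_sub ha hb))⟩

lemma vd_spec (hf : IsProperLscConvex f) (hg : IsProperLscConvex g) :
    vd f g ∈ closure (dom (conj f) + dom (conj g)) ∧
      ∀ c ∈ dom (conj f), ∀ d ∈ dom (conj g), ‖vd f g‖ ^ 2 ≤ ⟪vd f g, c + d⟫_ℝ := by
  obtain ⟨h1, h2⟩ := proj_zero_spec ((dom_conj_nonempty hf).add (dom_conj_nonempty hg)).closure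
    isClosed_closure ((convex_dom_conj hf).add (convex_dom_conj hg)).closure
  exact ⟨h1, fun c hc d hd => h2 _ (subset_closure (Set.add_mem_add hc hd))⟩

lemma exists_inner_neg_vp_le (hf : IsProperLscConvex f) (hg : IsProperLscConvex g) :
    ∃ m : ℝ, ∀ a ∈ dom f, ⟪a, -vp f g⟫_ℝ ≤ m := by
  obtain ⟨b, hb⟩ := hg.dom_nonempty
  refine ⟨-⟪vp f g, b⟫_ℝ, fun a ha => ?_⟩
  have := (vp_spec hf hg).2 a ha b hb
  rw [inner_sub_right] at this
  rw [inner_neg_right, real_inner_comm]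
  linarith [sq_nonneg ‖vp f g‖]

lemma exists_inner_vp_le (hf : IsProperLscConvex f) (hg : IsProperLscConvex g) :
    ∃ m : ℝ, ∀ b ∈ dom g, ⟪b, vp f g⟫_ℝ ≤ m := by
  obtain ⟨a, ha⟩ := hf.dom_nonempty
  refine ⟨⟪vp f g, a⟫_ℝ, fun b hb => ?_⟩
  have := (vp_spec hf hg).2 a ha b hb
  rw [inner_sub_right] at this
  rw [real_inner_comm]
  linarith [sq_nonneg ‖vp f g‖]

lemma exists_inner_neg_vd_le_left (hf : IsProperLscConvex f) (hg : IsProperLscConvex g) :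
    ∃ m : ℝ, ∀ c ∈ dom (conj f), ⟪c, -vd f g⟫_ℝ ≤ m := by
  obtain ⟨d, hd⟩ := dom_conj_nonempty hg
  refine ⟨⟪vd f g, d⟫_ℝ, fun c hc => ?_⟩
  have := (vd_spec hf hg).2 c hc d hd
  rw [inner_add_right] at this
  rw [inner_neg_right, real_inner_comm]
  linarith [sq_nonneg ‖vd f g‖]

lemma sub_smul_vd_mem_dom (hf : IsProperLscConvex f) (hg : IsProperLscConvex g) {t : ℝ}
    (ht : 0 ≤ t) {a : H} (ha : a ∈ dom f) : a - t • vd f g ∈ dom f := by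
  obtain ⟨m, hm⟩ := exists_inner_neg_vd_le_left hf hg
  obtain ⟨α, hα⟩ := exists_coe_eq hf ha
  have := mem_dom_of_le (add_smul_le hf hm ht hα.le)
  rwa [smul_neg, ← sub_eq_add_neg] at this

lemma sub_smul_vd_mem_dom_right (hf : IsProperLscConvex f) (hg : IsProperLscConvex g) {t : ℝ}
    (ht : 0 ≤ t) {b : H} (hb : b ∈ dom g) : b - t • vd f g ∈ dom g := by
  rw [← vd_comm]
  exact sub_smul_vd_mem_dom hg hf ht hb

lemma add_vp_mem_dom_conj (hf : IsProperLscConvex f) (hg : IsProperLscConvex g) {d : H}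
    (hd : d ∈ dom (conj g)) : d + vp f g ∈ dom (conj g) := by
  obtain ⟨m, hm⟩ := exists_inner_vp_le hf hg
  obtain ⟨γ, hγ⟩ := exists_conj_le hg hd
  have := mem_dom_of_le (conj_add_smul_le hm zero_le_one hγ)
  rwa [one_smul] at this

/-- `dom f` and `dom g` are both stable under translation by `-t v_d`, so moving either one alone
shifts `dom f - dom g` into itself in the directions `v_d` and `-v_d`; the nearest point to `0` is
therefore orthogonal to `v_d`. -/
lemma inner_vp_vd (hf : IsProperLscConvex f) (hg : IsProperLscConvex g) :
    ⟪vp f g, vd f g⟫_ℝ = 0 := by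
  obtain ⟨a, ha⟩ := hf.dom_nonempty
  obtain ⟨b, hb⟩ := hg.dom_nonempty
  have h := (vp_spec hf hg).2
  have key : ∀ z : ℝ, (∀ t : ℝ, 0 ≤ t → ‖vp f g‖ ^ 2 ≤ ⟪vp f g, a - b⟫_ℝ + t * z) → 0 ≤ z := by
    intro z hz
    by_contra! hneg
    have h1 := hz ((|⟪vp f g, a - b⟫_ℝ| + 1) / -z) (div_nonneg (by positivity) (by linarith))
    have h2 : (|⟪vp f g, a - b⟫_ℝ| + 1) / -z * z = -(|⟪vp f g, a - b⟫_ℝ| + 1) := by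
      rw [div_neg, neg_mul, div_mul_cancel₀ _ hneg.ne]
    linarith [le_abs_self ⟪vp f g, a - b⟫_ℝ, sq_nonneg ‖vp f g‖]
  apply le_antisymm
  · rw [← neg_nonneg]
    refine key _ fun t ht => ?_
    have := h _ (sub_smul_vd_mem_dom hf hg ht ha) b hb
    rw [sub_right_comm, inner_sub_right, inner_smul_right] at this
    linarith
  · refine key _ fun t ht => ?_
    have := h a ha _ (sub_smul_vd_mem_dom_right hf hg ht hb)
    rw [sub_sub_eq_add_sub, add_sub_right_comm, inner_add_right, inner_smul_right] at this
    exact this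

lemma exists_norm_sub_sub_le (hf : IsProperLscConvex f) (hg : IsProperLscConvex g) {ε : ℝ}
    (hε : 0 < ε) : ∃ a ∈ dom f, ∃ b ∈ dom g, ‖a - b - (vp f g + vd f g)‖ ≤ ε := by
  obtain ⟨_, ⟨a, ha, b, hb, rfl⟩, hab⟩ := Metric.mem_closure_iff.1 (vp_spec hf hg).1 ε hε
  refine ⟨a, ha, b - (1 : ℝ) • vd f g, sub_smul_vd_mem_dom_right hf hg zero_le_one hb, ?_⟩
  rw [dist_comm, dist_eq_norm] at hab
  refine le_of_eq_of_le (congrArg norm ?_) hab.le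
  module

lemma exists_norm_add_sub_le (hf : IsProperLscConvex f) (hg : IsProperLscConvex g) {ε : ℝ}
    (hε : 0 < ε) :
    ∃ c ∈ dom (conj f), ∃ d ∈ dom (conj g), ‖c + d - (vp f g + vd f g)‖ ≤ ε := by
  obtain ⟨_, ⟨c, hc, d, hd, rfl⟩, hcd⟩ := Metric.mem_closure_iff.1 (vd_spec hf hg).1 ε hε
  refine ⟨c, hc, d + vp f g, add_vp_mem_dom_conj hf hg hd, ?_⟩
  rw [dist_comm, dist_eq_norm] at hcd
  refine le_of_eq_of_le (congrArg norm ?_) hcd.le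
  module

/-! ### The displacement of one step -/

/-- The displacement `w = x - y` of a step lies in `dom f - dom g` and in `dom f* + dom g*`. -/
lemma norm_sq_le_inner_of_isSubgradient (hf : IsProperLscConvex f) (hg : IsProperLscConvex g)
    {x ν y μ : H} (hx : IsSubgradient f x ν) (hy : IsSubgradient g y μ) (hw : x - y = ν + μ) :
    ‖vp f g + vd f g‖ ^ 2 ≤ ⟪vp f g + vd f g, x - y⟫_ℝ := by
  have h1 := (vp_spec hf hg).2 x hx.mem_dom y hy.mem_dom
  have h2 := (vd_spec hf hg).2 ν hx.mem_dom_conj μ hy.mem_dom_conj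
  rw [← hw] at h2
  rw [norm_add_sq_real, inner_vp_vd hf hg, inner_add_left]
  linarith

/-- Upper bound on the correlation of `s = x + ν` with the deviation of the displacement from
`v_p + v_d`, up to an error that is an arbitrarily small multiple of `‖x‖ + ‖ν‖`. -/
lemma exists_inner_add_sub_le (hf : IsProperLscConvex f) (hg : IsProperLscConvex g) {ε : ℝ}
    (hε : 0 < ε) : ∃ C : ℝ, 0 ≤ C ∧ ∀ x ν y μ : H, IsSubgradient f x ν → IsSubgradient g y μ →
      x - y = ν + μ → ⟪x + ν, vp f g + vd f g - (x - y)⟫_ℝ ≤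
        C + C * ‖x - y‖ - ‖x - y‖ ^ 2 + ε * (‖x‖ + ‖ν‖) := by
  obtain ⟨a, ha, b, hb, hab⟩ := exists_norm_sub_sub_le hf hg hε
  obtain ⟨c, hc, d, hd, hcd⟩ := exists_norm_add_sub_le hf hg hε
  obtain ⟨α, hα⟩ := exists_coe_eq hf ha
  obtain ⟨β, hβ⟩ := exists_coe_eq hg hb
  obtain ⟨γ, hγ⟩ := exists_conj_le hf hc
  obtain ⟨δ, hδ⟩ := exists_conj_le hg hd
  set v := vp f g + vd f g
  refine ⟨|α + γ + (β + δ)| + ‖b - d‖, by positivity, fun x ν y μ hx hy hw => ?_⟩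
  have h1 := hx.inner_le hα.le hγ
  have h2 := hy.inner_le hβ.le hδ
  obtain ⟨w, hw'⟩ : ∃ w, w = x - y := ⟨_, rfl⟩
  have hμ : μ = w - ν := by rw [hw', hw]; abel
  have hy' : y = x - w := by rw [hw']; abel
  rw [← hw']
  -- The two inequalities add up to a bound in which only `w` pairs with the base points `b`, `d`.
  have h3 : ⟪ν, a⟫_ℝ + ⟪x, c⟫_ℝ - ⟪x, ν⟫_ℝ + (⟪μ, b⟫_ℝ + ⟪y, d⟫_ℝ - ⟪y, μ⟫_ℝ) =
      ⟪x + ν, v - w⟫_ℝ + ⟪ν, a - b - v⟫_ℝ + ⟪x, c + d - v⟫_ℝ + ⟪w, b - d⟫_ℝ + ‖w‖ ^ 2 := by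
    rw [hμ, hy', ← real_inner_self_eq_norm_sq]
    simp only [inner_sub_left, inner_sub_right, inner_add_left, inner_add_right]
    rw [real_inner_comm w ν]
    ring
  have h4 := neg_le_of_abs_le (abs_real_inner_le_norm ν (a - b - v))
  have h5 := neg_le_of_abs_le (abs_real_inner_le_norm x (c + d - v))
  have h6 := neg_le_of_abs_le (abs_real_inner_le_norm w (b - d))
  have h7 := mul_le_mul_of_nonneg_left hab (norm_nonneg ν)
  have h8 := mul_le_mul_of_nonneg_left hcd (norm_nonneg x)
  have h9 := le_abs_self (α + γ + (β + δ))
  have h10 := mul_nonneg (abs_nonneg (α + γ + (β + δ))) (norm_nonneg w)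
  have h11 := norm_nonneg (b - d)
  linarith

/-- The companion estimate that separates the primal from the dual part of `x + ν`: the inner
product below is bounded from below by a quantity linear in `t`, `‖x‖` and `‖ν‖`. -/
lemma exists_neg_le_inner (hf : IsProperLscConvex f) (hg : IsProperLscConvex g) :
    ∃ C : ℝ, 0 ≤ C ∧ ∀ (x ν : H) (t : ℝ), IsSubgradient f x ν → 0 ≤ t →
      -(C * (1 + t + ‖x‖ + ‖ν‖)) ≤ ⟪x + t • vd f g, ν + t • vp f g⟫_ℝ := by
  obtain ⟨a, ha⟩ := hf.dom_nonempty
  obtain ⟨c, hc⟩ := dom_conj_nonempty hf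
  obtain ⟨α, hα⟩ := exists_coe_eq hf ha
  obtain ⟨γ, hγ⟩ := exists_conj_le hf hc
  obtain ⟨m, hm⟩ := exists_inner_neg_vd_le_left hf hg
  obtain ⟨m', hm'⟩ := exists_inner_neg_vp_le hf hg
  refine ⟨|α + γ| + |m + m'| + ‖a‖ + ‖c‖, by positivity, fun x ν t h ht => ?_⟩
  have h1 := h.inner_le (add_smul_le hf hm ht hα.le) (conj_add_smul_le hm' ht hγ)
  have h2 : ⟪ν, a + t • -vd f g⟫_ℝ + ⟪x, c + t • -vp f g⟫_ℝ - ⟪x, ν⟫_ℝ =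
      ⟪ν, a⟫_ℝ + ⟪x, c⟫_ℝ - ⟪x + t • vd f g, ν + t • vp f g⟫_ℝ := by
    simp only [inner_add_left, inner_add_right, inner_smul_left, inner_smul_right,
      inner_neg_right, conj_trivial]
    rw [real_inner_comm (vp f g) (vd f g), inner_vp_vd hf hg, real_inner_comm ν (vd f g)]
    ring
  rw [h2] at h1
  have h3 := neg_le_of_abs_le (abs_real_inner_le_norm ν a)
  have h4 := neg_le_of_abs_le (abs_real_inner_le_norm x c)
  have h5 := le_abs_self (α + γ)
  have h6 := mul_le_mul_of_nonneg_left (le_abs_self (m + m')) ht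
  have h7 : 0 ≤ (|α + γ| + ‖a‖ + ‖c‖) * t := by positivity
  have h8 : 0 ≤ (|m + m'| + ‖a‖ + ‖c‖) * 1 := by positivity
  have h9 : 0 ≤ (|α + γ| + |m + m'| + ‖a‖) * ‖x‖ := by positivity
  have h10 : 0 ≤ (|α + γ| + |m + m'| + ‖c‖) * ‖ν‖ := by positivity
  linarith

end Displacement

/-! ### Growth of the iterates -/

/-- A nonnegative sequence whose square increases by at most `δ (r n + n)` per step, up to a
constant depending on `δ`, is sublinear. -/
lemma isLittleO_of_sq_succ_le {r : ℕ → ℝ} (hr : ∀ n, 0 ≤ r n)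
    (h : ∀ δ : ℝ, 0 < δ → ∃ C : ℝ, ∀ n : ℕ, r (n + 1) ^ 2 ≤ r n ^ 2 + C + δ * (r n + n)) :
    r =o[atTop] (fun n : ℕ => (n : ℝ)) := by
  -- With `δ = η²`, the bound `r n ≤ η n + M` propagates as soon as `M` is large.
  have key : ∀ η : ℝ, 0 < η → η ≤ 1 → ∃ M : ℝ, ∀ n : ℕ, r n ≤ η * n + M := by
    intro η hη hη1
    obtain ⟨C, hC⟩ := h (η ^ 2) (by positivity)
    refine ⟨max (r 0) (C / η), fun n => ?_⟩
    set M := max (r 0) (C / η)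
    have hM0 : 0 ≤ M := (hr 0).trans (le_max_left _ _)
    have hMC : C ≤ η * M := by
      have : C / η ≤ M := le_max_right _ _
      rwa [div_le_iff₀' hη] at this
    induction n with
    | zero =>
      rw [Nat.cast_zero, mul_zero, zero_add]
      exact le_max_left _ _
    | succ n ih =>
      have hn : (0 : ℝ) ≤ n := n.cast_nonneg
      have hB : 0 ≤ η * n + M := by positivity
      refine abs_le_of_sq_le_sq' ?_ (by positivity) |>.2
      have h1 : r n ^ 2 ≤ (η * n + M) ^ 2 := pow_le_pow_left₀ (hr n) ih 2
      have h2 : η ^ 2 * (r n + n) ≤ η ^ 2 * (η * n + M + n) := by gcongr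
      have h3 : η ^ 2 * (η * n) ≤ η ^ 2 * (1 * n) := by gcongr
      have h4 : η * η * M ≤ η * 1 * M := by gcongr
      have h5 := sq_nonneg η
      push_cast
      nlinarith [hC n]
  refine Asymptotics.isLittleO_iff.2 fun c hc => ?_
  obtain ⟨M, hM⟩ := key (min (c / 2) 1) (by positivity) (min_le_right _ _)
  filter_upwards [eventually_ge_atTop ⌈M / (c / 2)⌉₊] with n hn
  have h1 : M / (c / 2) ≤ n := (Nat.le_ceil _).trans (by exact_mod_cast hn)
  rw [div_le_iff₀ (by positivity)] at h1
  have h2 : min (c / 2) 1 * (n : ℝ) ≤ c / 2 * n := by gcongr; exact min_le_left _ _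
  rw [Real.norm_of_nonneg (hr n), Real.norm_of_nonneg n.cast_nonneg]
  linarith [hM n]

section Iterates

variable {H : Type*} [NormedAddCommGroup H] [InnerProductSpace ℝ H] {f g : H → EReal}

lemma sSeq_succ (f g : H → EReal) (s₀ : H) (n : ℕ) :
    sSeq f g s₀ (n + 1) = sSeq f g s₀ n + xtSeq f g s₀ n - xSeq f g s₀ n := rfl

lemma xSeq_add_nuSeq (f g : H → EReal) (s₀ : H) (n : ℕ) :
    xSeq f g s₀ n + nuSeq f g s₀ n = sSeq f g s₀ n := by
  simp [nuSeq]

variable [FiniteDimensional ℝ H]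

lemma isSubgradient_xSeq (hf : IsProperLscConvex f) (g : H → EReal) (s₀ : H) (n : ℕ) :
    IsSubgradient f (xSeq f g s₀ n) (nuSeq f g s₀ n) :=
  isSubgradient_prox hf _

lemma isSubgradient_xtSeq (f : H → EReal) (hg : IsProperLscConvex g) (s₀ : H) (n : ℕ) :
    IsSubgradient g (xtSeq f g s₀ n)
      ((2 : ℝ) • xSeq f g s₀ n - sSeq f g s₀ n - xtSeq f g s₀ n) :=
  isSubgradient_prox hg _

/-- `s_n = -n (v_p + v_d) + o(n)`. -/
lemma isLittleO_sSeq_add (hf : IsProperLscConvex f) (hg : IsProperLscConvex g) (s₀ : H) :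
    (fun n : ℕ => sSeq f g s₀ n + (n : ℝ) • (vp f g + vd f g)) =o[atTop]
      (fun n : ℕ => (n : ℝ)) := by
  have : CompleteSpace H := FiniteDimensional.complete ℝ H
  rw [← Asymptotics.isLittleO_norm_left]
  refine isLittleO_of_sq_succ_le (fun n => norm_nonneg _) fun δ hδ => ?_
  set v := vp f g + vd f g with hv
  obtain ⟨K, hK0, hK⟩ := exists_norm_prox_le hf
  -- `‖x‖ + ‖ν‖ ≤ 2 (‖u‖ + n ‖v‖ + K)`, and passing to squared norms doubles the inner product:
  -- hence the factor `4`.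
  obtain ⟨C, hC0, hC⟩ := exists_inner_add_sub_le hf hg
    (ε := δ / (4 * (1 + ‖v‖))) (by positivity)
  set ε := δ / (4 * (1 + ‖v‖))
  have hε0 : 0 < ε := by positivity
  have hε : ε * (4 * (1 + ‖v‖)) = δ := div_mul_cancel₀ _ (by positivity)
  refine ⟨2 * C + ‖v‖ ^ 2 + (C + ‖v‖) ^ 2 + 4 * ε * K, fun n => ?_⟩
  have hx := isSubgradient_xSeq hf g s₀ n
  have hy := isSubgradient_xtSeq f hg s₀ n
  have hsum := xSeq_add_nuSeq f g s₀ n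
  have hsucc := sSeq_succ f g s₀ n
  have hxK : ‖xSeq f g s₀ n‖ ≤ ‖sSeq f g s₀ n‖ + K := (hK _).1
  have hνK : ‖nuSeq f g s₀ n‖ ≤ ‖sSeq f g s₀ n‖ + K := (hK _).2
  have hw : xSeq f g s₀ n - xtSeq f g s₀ n = nuSeq f g s₀ n +
      ((2 : ℝ) • xSeq f g s₀ n - sSeq f g s₀ n - xtSeq f g s₀ n) := by
    rw [nuSeq]; module
  have h1 := hC _ _ _ _ hx hy hw
  have h2 := norm_sq_le_inner_of_isSubgradient hf hg hx hy hw
  rw [hsum, ← hv] at h1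
  rw [← hv] at h2
  set s := sSeq f g s₀ n
  set w := xSeq f g s₀ n - xtSeq f g s₀ n with hw'
  set u := s + (n : ℝ) • v with hu
  have hu' : sSeq f g s₀ (n + 1) + ((n + 1 : ℕ) : ℝ) • v = u + (v - w) := by
    rw [hsucc, hu, hw']; push_cast; module
  have h3 : ⟪u, v - w⟫_ℝ = ⟪s, v - w⟫_ℝ + n * (‖v‖ ^ 2 - ⟪v, w⟫_ℝ) := by
    rw [hu, inner_add_left, inner_smul_left, inner_sub_right v, real_inner_self_eq_norm_sq]
    simp
  have h4 : (n : ℝ) * (‖v‖ ^ 2 - ⟪v, w⟫_ℝ) ≤ 0 :=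
    mul_nonpos_of_nonneg_of_nonpos n.cast_nonneg (by linarith)
  have h5 : ‖v - w‖ ^ 2 ≤ ‖v‖ ^ 2 + 2 * (‖v‖ * ‖w‖) + ‖w‖ ^ 2 := by
    rw [norm_sub_sq_real]
    linarith [neg_le_of_abs_le (abs_real_inner_le_norm v w)]
  have h6 : ‖s‖ ≤ ‖u‖ + n * ‖v‖ := by
    have : s = u - (n : ℝ) • v := by rw [hu]; abel
    calc ‖s‖ ≤ ‖u‖ + ‖(n : ℝ) • v‖ := by rw [this]; exact norm_sub_le _ _
      _ = ‖u‖ + n * ‖v‖ := by rw [norm_smul, Real.norm_of_nonneg n.cast_nonneg]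
  have h7 : ε * (‖xSeq f g s₀ n‖ + ‖nuSeq f g s₀ n‖) ≤ ε * (2 * (‖u‖ + n * ‖v‖ + K)) := by
    gcongr; linarith
  have h8 : 0 ≤ ε * (4 * (‖v‖ * ‖u‖ + n)) := by positivity
  rw [hu', norm_add_sq_real, h3, ← hε]
  nlinarith [sq_nonneg (C + ‖v‖ - ‖w‖)]

/-- `x_n = -n v_d + o(n)`. -/
lemma isLittleO_xSeq_add (hf : IsProperLscConvex f) (hg : IsProperLscConvex g) (s₀ : H) :
    (fun n : ℕ => xSeq f g s₀ n + (n : ℝ) • vd f g) =o[atTop] (fun n : ℕ => (n : ℝ)) := by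
  have : CompleteSpace H := FiniteDimensional.complete ℝ H
  have hs := (isLittleO_sSeq_add hf hg s₀).norm_left
  obtain ⟨K, hK0, hK⟩ := exists_norm_prox_le hf
  obtain ⟨C, hC0, hC⟩ := exists_neg_le_inner hf hg
  set v := vp f g + vd f g with hv
  set r : ℕ → ℝ := fun n => ‖sSeq f g s₀ n + (n : ℝ) • v‖ with hr
  set D := 2 * C * (1 + 2 * K + 2 + 2 * ‖v‖) with hD
  have hbound : ∀ n : ℕ, 1 ≤ n →
      ‖xSeq f g s₀ n + (n : ℝ) • vd f g‖ ^ 2 ≤ r n * r n + D * (n + r n) := by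
    intro n hn
    have hn1 : (1 : ℝ) ≤ n := by exact_mod_cast hn
    have h1 := hC _ _ n (isSubgradient_xSeq hf g s₀ n) n.cast_nonneg
    have hxK : ‖xSeq f g s₀ n‖ ≤ ‖sSeq f g s₀ n‖ + K := (hK _).1
    have hνK : ‖nuSeq f g s₀ n‖ ≤ ‖sSeq f g s₀ n‖ + K := (hK _).2
    have h2 : ‖sSeq f g s₀ n‖ ≤ r n + n * ‖v‖ := by
      have : sSeq f g s₀ n = (sSeq f g s₀ n + (n : ℝ) • v) - (n : ℝ) • v := by abel
      calc ‖sSeq f g s₀ n‖ ≤ r n + ‖(n : ℝ) • v‖ := by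
            conv_lhs => rw [this]
            exact norm_sub_le _ _
        _ = r n + n * ‖v‖ := by rw [norm_smul, Real.norm_of_nonneg n.cast_nonneg]
    have h3 : r n * r n = ‖xSeq f g s₀ n + (n : ℝ) • vd f g‖ ^ 2 +
        2 * ⟪xSeq f g s₀ n + (n : ℝ) • vd f g, nuSeq f g s₀ n + (n : ℝ) • vp f g⟫_ℝ +
        ‖nuSeq f g s₀ n + (n : ℝ) • vp f g‖ ^ 2 := by
      rw [← norm_add_sq_real, ← sq]
      refine congrArg (fun z : H => ‖z‖ ^ 2) ?_
      rw [hv, ← xSeq_add_nuSeq f g s₀ n]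
      module
    have hr0 : 0 ≤ r n := norm_nonneg _
    have h4 : 1 + (n : ℝ) + ‖xSeq f g s₀ n‖ + ‖nuSeq f g s₀ n‖ ≤
        (1 + 2 * K + 2 + 2 * ‖v‖) * (n + r n) := by
      have h5 : 0 ≤ (1 + 2 * K) * (n - 1) := mul_nonneg (by positivity) (by linarith)
      have h6 : 0 ≤ (1 + 2 * K + 2 * ‖v‖) * r n := by positivity
      linarith
    have h7 := mul_le_mul_of_nonneg_left h4 hC0
    rw [hD]
    linarith [sq_nonneg ‖nuSeq f g s₀ n + (n : ℝ) • vp f g‖]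
  have hone : (fun _ : ℕ => D) =o[atTop] (fun n : ℕ => (n : ℝ)) :=
    Asymptotics.isLittleO_const_left.2 (Or.inr
      (tendsto_norm_atTop_atTop.comp tendsto_natCast_atTop_atTop))
  have hlin : (fun n : ℕ => (n : ℝ) + r n) =O[atTop] (fun n : ℕ => (n : ℝ)) :=
    (Asymptotics.isBigO_refl _ _).add hs.isBigO
  have hsq : (fun n : ℕ => ‖xSeq f g s₀ n + (n : ℝ) • vd f g‖ ^ 2) =o[atTop]
      (fun n : ℕ => (n : ℝ) ^ 2) := by
    have h1 : (fun n : ℕ => r n * r n + D * (n + r n)) =o[atTop]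
        (fun n : ℕ => (n : ℝ) * (n : ℝ)) := (hs.mul hs).add (hone.mul_isBigO hlin)
    simp_rw [sq (Nat.cast _ : ℝ)]
    refine Asymptotics.IsBigO.trans_isLittleO (Asymptotics.IsBigO.of_bound 1 ?_) h1
    filter_upwards [eventually_ge_atTop 1] with n hn
    rw [one_mul, Real.norm_of_nonneg (sq_nonneg _)]
    exact (hbound n hn).trans (le_abs_self _)
  exact (hsq.of_pow two_ne_zero).of_norm_left

end Iterates

end DouglasRachford

open DouglasRachford in
theorem mainTheorem6 {H : Type*} [NormedAddCommGroup H] [InnerProductSpace ℝ H]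
    [FiniteDimensional ℝ H] (f g : H → EReal)
    (hf : DouglasRachford.IsProperLscConvex f) (hg : DouglasRachford.IsProperLscConvex g)
    (s₀ : H) :
    Tendsto
      (fun n : ℕ => (-(1 / (n : ℝ))) •
        (DouglasRachford.xSeq f g s₀ n, DouglasRachford.xtSeq f g s₀ n,
          DouglasRachford.nuSeq f g s₀ n))
      atTop
      (𝓝 (DouglasRachford.vd f g, DouglasRachford.vd f g, DouglasRachford.vp f g)) := by
  have hs := isLittleO_sSeq_add hf hg s₀
  have hx := isLittleO_xSeq_add hf hg s₀
  set v := vp f g + vd f g with hv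
  have hν : (fun n : ℕ => nuSeq f g s₀ n + (n : ℝ) • vp f g) =o[atTop]
      (fun n : ℕ => (n : ℝ)) := by
    refine (hs.sub hx).congr_left fun n => ?_
    rw [← xSeq_add_nuSeq f g s₀ n, hv]
    module
  have hconst : (fun _ : ℕ => v) =o[atTop] (fun n : ℕ => (n : ℝ)) :=
    Asymptotics.isLittleO_const_left.2 (Or.inr
      (tendsto_norm_atTop_atTop.comp tendsto_natCast_atTop_atTop))
  have hs' : (fun n : ℕ => sSeq f g s₀ (n + 1) + ((n + 1 : ℕ) : ℝ) • v) =o[atTop]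
      (fun n : ℕ => (n : ℝ)) := by
    refine (hs.comp_tendsto (tendsto_add_atTop_nat 1)).trans_isBigO
      (Asymptotics.IsBigO.of_bound 2 ?_)
    filter_upwards [eventually_ge_atTop 1] with n hn
    have hn1 : (1 : ℝ) ≤ n := by exact_mod_cast hn
    simp only [Function.comp_apply, Real.norm_natCast]
    push_cast
    linarith
  -- The gap `x̃_n - x_n = s_{n+1} - s_n` is `o(n)`.
  have hxt : (fun n : ℕ => xtSeq f g s₀ n + (n : ℝ) • vd f g) =o[atTop]
      (fun n : ℕ => (n : ℝ)) := by
    refine (((hs'.sub hs).sub hconst).add hx).congr_left fun n => ?_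
    rw [sSeq_succ]
    push_cast
    module
  have key : ∀ (z : ℕ → H) (d : H),
      (fun n : ℕ => z n + (n : ℝ) • d) =o[atTop] (fun n : ℕ => (n : ℝ)) →
      Tendsto (fun n : ℕ => (-(1 / (n : ℝ))) • z n) atTop (𝓝 d) := by
    intro z d h
    have h1 := h.tendsto_inv_smul_nhds_zero.const_sub d
    rw [sub_zero] at h1
    refine h1.congr' ?_
    filter_upwards [eventually_ge_atTop 1] with n hn
    have hn0 : (n : ℝ) ≠ 0 := by positivity
    rw [smul_add, inv_smul_smul₀ hn0, one_div]
    module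
  exact (key _ _ hx).prodMk_nhds ((key _ _ hxt).prodMk_nhds (key _ _ hν))
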